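/- There are $m=3$ objects. A ranking is a permutation $\sigma$ of $\{1,2,3\}$, where $\sigma(i)$ is the rank of object $i$ and $\sigma^{-1}(1)$ is the top ranked object; a relevance vector is $r\in\{0,1\}^3$. Let $$\mathrm{SumLoss}(\sigma,r)=\sum_{i=1}^3\sigma(i)\,r(i),\qquad \mathrm{PairwiseLoss}(\sigma,r)=\sum_{i=1}^3\sum_{j=1}^3 \mathbf 1(\sigma(i)<\sigma(j))\,\mathbf 1(r(i)<r(j)).$$ An oblivious adversary fixes relevance vectors $r_1,\dots,r_T$ in advance. In each round $t=1,\dots,T$ the learner outputs a ranking $\sigma_t$, possibly using internal randomization, based only on the feedback received in earlier rounds, and then observes only the relevance $r_t(\sigma_t^{-1}(1))$ of its top ranked object (top-1 feedback). There is an absolute constant $c>0$ such that for every (possibly randomized) online learning algorithm and every horizon $T\ge 1$ there are relevance vectors $r_1,\dots,r_T\in\{0,1\}^3$ with $$\mathbb E\Big[\sum_{t=1}^T \mathrm{SumLoss}(\sigma_t,r_t)\Big]-\min_{\sigma}\sum_{t=1}^T \mathrm{SumLoss}(\sigma,r_t)\ \ge\ c\,T^{2/3},$$ where the expectation is over the learner's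 randomization; for the same relevance vectors the same inequality also holds with $\mathrm{PairwiseLoss}$ in place of $\mathrm{SumLoss}$. -/

import Mathlib

open MeasureTheory

/-- A ranking of `m` objects, as a map from objects to positions. Objects and positions are numbered
from `0`: object `i` is placed at rank `σ i + 1`, and the top ranked object is `σ.symm 0`. -/
abbrev Ranking (m : ℕ) := Equiv.Perm (Fin m)

/-- A binary relevance vector `r ∈ {0,1}^m`. -/
abbrev Relevance (m : ℕ) := Fin m → Fin 2

/-- `SumLoss(σ, r) = ∑ i, σ(i) r(i)`, with ranks `σ(i) ∈ {1, …, m}`. -/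
noncomputable def sumLoss {m : ℕ} (σ : Ranking m) (r : Relevance m) : ℝ :=
  ∑ i : Fin m, (((σ i : ℕ) : ℝ) + 1) * ((r i : ℕ) : ℝ)

/-- `PairwiseLoss(σ, r) = ∑ i, ∑ j, 1(σ(i) < σ(j)) 1(r(i) < r(j))`. -/
noncomputable def pairwiseLoss {m : ℕ} (σ : Ranking m) (r : Relevance m) : ℝ :=
  ∑ i : Fin m, ∑ j : Fin m, (if σ i < σ j then 1 else 0) * (if r i < r j then 1 else 0)

/-- Top-1 feedback: the relevance of the top ranked object. -/
def topFeedback {m : ℕ} [NeZero m] (σ : Ranking m) (r : Relevance m) : Fin 2 :=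
  r (σ.symm 0)

/-- A randomized online ranking algorithm with top-1 feedback. All of its internal randomization is
a random seed `ω : Ω`; given the seed, the ranking it outputs is a function of the list of feedbacks
of the previous rounds, oldest first (the round number is the length of this list, and the previous
rankings are determined by the seed and the previous feedbacks). -/
structure OnlineAlgorithm (m : ℕ) (Ω : Type*) [MeasurableSpace Ω] where
  act : Ω → List (Fin 2) → Ranking m
  measurableSet_act : ∀ (h : List (Fin 2)) (σ : Ranking m), MeasurableSet {ω | act ω h = σ}

namespace OnlineAlgorithm

variable {m : ℕ} [NeZero m] {Ω : Type*} [MeasurableSpace Ω]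

/-- The feedbacks received in the first `t` rounds (rounds `0, …, t - 1`) against the relevance
vectors `r 0, r 1, …`, when the seed is `ω`. -/
def history (A : OnlineAlgorithm m Ω) (r : ℕ → Relevance m) (ω : Ω) : ℕ → List (Fin 2)
  | 0 => []
  | t + 1 => A.history r ω t ++ [topFeedback (A.act ω (A.history r ω t)) (r t)]

/-- The ranking `σ_t` output in round `t`. -/
def ranking (A : OnlineAlgorithm m Ω) (r : ℕ → Relevance m) (ω : Ω) (t : ℕ) : Ranking m :=
  A.act ω (A.history r ω t)

/-- The expected regret over the rounds `0, …, T - 1`: the expected total loss, with the seed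
distributed according to `μ`, minus the total loss of the best fixed ranking in hindsight. -/
noncomputable def regret (A : OnlineAlgorithm m Ω) (loss : Ranking m → Relevance m → ℝ)
    (μ : Measure Ω) (r : ℕ → Relevance m) (T : ℕ) : ℝ :=
  (∫ ω, ∑ t ∈ Finset.range T, loss (A.ranking r ω t) (r t) ∂μ) -
    Finset.univ.inf' Finset.univ_nonempty
      (fun σ : Ranking m => ∑ t ∈ Finset.range T, loss σ (r t))

theorem measurableSet_history (A : OnlineAlgorithm m Ω) (r : ℕ → Relevance m) (t : ℕ) :
    ∀ h : List (Fin 2), MeasurableSet {ω | A.history r ω t = h} := by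
  induction t with
  | zero => intro h; simp [history]
  | succ t ih =>
    intro h
    have e : {ω | A.history r ω (t + 1) = h} = ⋃ (h' : List (Fin 2)) (σ : Ranking m)
        (_ : h' ++ [topFeedback σ (r t)] = h), {ω | A.history r ω t = h'} ∩ {ω | A.act ω h' = σ} := by
      ext ω
      simp only [history, Set.mem_ofPred_eq, Set.mem_iUnion, Set.mem_inter_iff, exists_prop]
      constructor
      · intro hh
        exact ⟨_, _, hh, rfl, rfl⟩
      · rintro ⟨h', σ, hh, rfl, rfl⟩
        exact hh
    rw [e]
    exact MeasurableSet.iUnion fun h' => MeasurableSet.iUnion fun σ => MeasurableSet.iUnion fun _ =>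
      (ih h').inter (A.measurableSet_act h' σ)

theorem measurableSet_ranking (A : OnlineAlgorithm m Ω) (r : ℕ → Relevance m) (t : ℕ)
    (σ : Ranking m) : MeasurableSet {ω | A.ranking r ω t = σ} := by
  have e : {ω | A.ranking r ω t = σ} = ⋃ h : List (Fin 2),
      {ω | A.history r ω t = h} ∩ {ω | A.act ω h = σ} := by
    ext ω
    simp [ranking]
  rw [e]
  exact MeasurableSet.iUnion fun h =>
    (A.measurableSet_history r t h).inter (A.measurableSet_act h σ)

/-- The total loss is integrable, so the integral in `regret` is a genuine expectation. -/
theorem integrable_loss (A : OnlineAlgorithm m Ω) (loss : Ranking m → Relevance m → ℝ)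
    (μ : Measure Ω) [IsProbabilityMeasure μ] (r : ℕ → Relevance m) (T : ℕ) :
    Integrable (fun ω => ∑ t ∈ Finset.range T, loss (A.ranking r ω t) (r t)) μ := by
  refine integrable_finsetSum _ fun t _ => ?_
  have e : (fun ω => loss (A.ranking r ω t) (r t)) = fun ω => ∑ σ : Ranking m,
      Set.indicator {ω | A.ranking r ω t = σ} (fun _ => loss σ (r t)) ω := by
    ext ω
    simp [Set.indicator_apply]
  rw [e]
  exact integrable_finsetSum _ fun σ _ =>
    (integrable_const _).indicator (A.measurableSet_ranking r t σ)

end OnlineAlgorithm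

/-! Object `0` is always relevant and an i.i.d. bit of bias `1/2 ± ε` decides which of objects `1`,
`2` is relevant too. The optimal ranking puts object `0` on top, where the feedback is always `1`
and reveals nothing; learning the sign of the bias means putting `1` or `2` on top, at constant
excess loss. Misordering `1` and `2` costs `2ε`, and detecting the bias takes about `ε⁻²`
explorations, so `ε ~ T^(-1/3)` forces regret of order `T^(2/3)`. `strategyLoss_lower_bound` proves
this by induction on the remaining rounds, with `u`, `v` the unnormalized posterior weights of the
two biases; `harmonic_split_le` bounds what one observation can reveal. Averaging then yields a
fixed bit list. -/

/-- The relevance vectors `(1, 1, 0)` and `(1, 0, 1)`: object `0` is always relevant, and exactly one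
of the objects `1` and `2` is. -/
def bitRelevance (x : Fin 2) : Relevance 3 := ![1, x, 1 - x]

/-- The average of `F` over the lists of `n` independent bits, each being `1` with probability `p`. -/
noncomputable def bitAverage (p : ℝ) : ℕ → (List (Fin 2) → ℝ) → ℝ
  | 0, F => F []
  | n + 1, F => p * bitAverage p n (fun l => F (1 :: l)) +
      (1 - p) * bitAverage p n (fun l => F (0 :: l))

/-- The total `sumLoss` of the deterministic strategy `act`, started with the feedback list `h`,
against the relevance vectors encoded by a list of bits. -/
noncomputable def strategyLoss (act : List (Fin 2) → Ranking 3) :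
    List (Fin 2) → List (Fin 2) → ℝ
  | _, [] => 0
  | h, x :: l => sumLoss (act h) (bitRelevance x) +
      strategyLoss act (h ++ [topFeedback (act h) (bitRelevance x)]) l

section bitAverage

variable {p : ℝ}

theorem bitAverage_add (n : ℕ) (F G : List (Fin 2) → ℝ) :
    bitAverage p n (fun l => F l + G l) = bitAverage p n F + bitAverage p n G := by
  induction n generalizing F G with
  | zero => rfl
  | succ n ih => simp only [bitAverage, ih]; ring

theorem bitAverage_const (n : ℕ) (a : ℝ) : bitAverage p n (fun _ => a) = a := by
  induction n with
  | zero => rfl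
  | succ n ih => simp only [bitAverage, ih]; ring

theorem bitAverage_const_add (n : ℕ) (a : ℝ) (F : List (Fin 2) → ℝ) :
    bitAverage p n (fun l => a + F l) = a + bitAverage p n F := by
  rw [bitAverage_add, bitAverage_const]

theorem bitAverage_sum_map (n : ℕ) (f : Fin 2 → ℝ) :
    bitAverage p n (fun l => (l.map f).sum) = n * (p * f 1 + (1 - p) * f 0) := by
  induction n with
  | zero => simp [bitAverage]
  | succ n ih =>
    simp only [bitAverage, List.map_cons, List.sum_cons, bitAverage_const_add, ih]
    push_cast
    ring

/-- Passes from random bits to an oblivious adversary: some value is at least the mean. -/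
theorem exists_bitAverage_le (hp : 0 ≤ p) (hp' : p ≤ 1) (n : ℕ) (F : List (Fin 2) → ℝ) :
    ∃ l : List (Fin 2), l.length = n ∧ bitAverage p n F ≤ F l := by
  induction n generalizing F with
  | zero => exact ⟨[], rfl, le_rfl⟩
  | succ n ih =>
    obtain ⟨l₁, h₁, h₁'⟩ := ih (fun l => F (1 :: l))
    obtain ⟨l₀, h₀, h₀'⟩ := ih (fun l => F (0 :: l))
    have key : bitAverage p (n + 1) F ≤ p * F (1 :: l₁) + (1 - p) * F (0 :: l₀) :=
      add_le_add (mul_le_mul_of_nonneg_left h₁' hp)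
        (mul_le_mul_of_nonneg_left h₀' (sub_nonneg.2 hp'))
    rcases le_total (F (1 :: l₁)) (F (0 :: l₀)) with h | h
    · exact ⟨0 :: l₀, by simp [h₀], by nlinarith⟩
    · exact ⟨1 :: l₁, by simp [h₁], by nlinarith⟩

theorem integrable_bitAverage_and_integral {Ω : Type*} [MeasurableSpace Ω] {μ : Measure Ω} (n : ℕ)
    (F : Ω → List (Fin 2) → ℝ) (hF : ∀ l, Integrable (fun ω => F ω l) μ) :
    Integrable (fun ω => bitAverage p n (F ω)) μ ∧
      ∫ ω, bitAverage p n (F ω) ∂μ = bitAverage p n (fun l => ∫ ω, F ω l ∂μ) := by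
  induction n generalizing F with
  | zero => exact ⟨hF [], rfl⟩
  | succ n ih =>
    obtain ⟨i₁, e₁⟩ := ih (fun ω l => F ω (1 :: l)) fun l => hF _
    obtain ⟨i₀, e₀⟩ := ih (fun ω l => F ω (0 :: l)) fun l => hF _
    refine ⟨(i₁.const_mul p).add (i₀.const_mul (1 - p)), ?_⟩
    simp only [bitAverage]
    rw [integral_add (i₁.const_mul p) (i₀.const_mul (1 - p)), integral_const_mul,
      integral_const_mul, e₁, e₀]

end bitAverage

/-! ### Losses on the hard instances -/

theorem sumLoss_bitRelevance_one (σ : Ranking 3) :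
    sumLoss σ (bitRelevance 1) = ((σ 0 : ℕ) : ℝ) + (σ 1 : ℕ) + 2 := by
  simp [sumLoss, bitRelevance, Fin.sum_univ_three]
  ring

theorem sumLoss_bitRelevance_zero (σ : Ranking 3) :
    sumLoss σ (bitRelevance 0) = ((σ 0 : ℕ) : ℝ) + (σ 2 : ℕ) + 2 := by
  simp [sumLoss, bitRelevance, Fin.sum_univ_three]
  ring

theorem ranking_three_cases : ∀ σ : Ranking 3,
    (σ.symm 0 = 0 ∧ (σ 0 = 0 ∧ σ 1 = 1 ∧ σ 2 = 2 ∨ σ 0 = 0 ∧ σ 1 = 2 ∧ σ 2 = 1)) ∨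
    (σ.symm 0 = 1 ∧ (σ 0 = 1 ∧ σ 1 = 0 ∧ σ 2 = 2 ∨ σ 0 = 2 ∧ σ 1 = 0 ∧ σ 2 = 1)) ∨
    (σ.symm 0 = 2 ∧ (σ 0 = 1 ∧ σ 1 = 2 ∧ σ 2 = 0 ∨ σ 0 = 2 ∧ σ 1 = 1 ∧ σ 2 = 0)) := by
  decide

/-- With one irrelevant object, both losses count the relevant objects ranked below it, up to the
constant `1 + 2`. -/
theorem pairwiseLoss_bitRelevance (σ : Ranking 3) (x : Fin 2) :
    pairwiseLoss σ (bitRelevance x) = sumLoss σ (bitRelevance x) - 3 := by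
  fin_cases x <;>
  rcases ranking_three_cases σ with ⟨-, ⟨h0, h1, h2⟩ | ⟨h0, h1, h2⟩⟩ |
    ⟨-, ⟨h0, h1, h2⟩ | ⟨h0, h1, h2⟩⟩ | ⟨-, ⟨h0, h1, h2⟩ | ⟨h0, h1, h2⟩⟩ <;>
  simp [pairwiseLoss, sumLoss, bitRelevance, Fin.sum_univ_three, h0, h1, h2] <;> norm_num

/-! ### Bayesian lower bound for deterministic strategies -/

/-- The harmonic potential of two weights loses at most a fraction `4 ε ^ 2` when the weights are
split by a bit of bias `± ε`. -/
theorem harmonic_split_le {u v ε : ℝ} (hu : 0 < u) (hv : 0 < v) (hε : 0 ≤ ε) (hε' : ε ≤ 1 / 4) :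
    (1 - 4 * ε ^ 2) * (u * v / (u + v)) ≤
      (u * (1 / 2 + ε)) * (v * (1 / 2 - ε)) / (u * (1 / 2 + ε) + v * (1 / 2 - ε)) +
      (u * (1 / 2 - ε)) * (v * (1 / 2 + ε)) / (u * (1 / 2 - ε) + v * (1 / 2 + ε)) := by
  have h1 : 0 < 1 / 2 + ε := by linarith
  have h2 : 0 < 1 / 2 - ε := by linarith
  have hA : 0 < u * (1 / 2 + ε) + v * (1 / 2 - ε) := by positivity
  have hB : 0 < u * (1 / 2 - ε) + v * (1 / 2 + ε) := by positivity
  -- AM-GM: the two denominators add up to `u + v`. Both numerators equal `u * v * (1 / 4 - ε ^ 2)`.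
  have hAB : (u * (1 / 2 + ε) + v * (1 / 2 - ε)) * (u * (1 / 2 - ε) + v * (1 / 2 + ε)) ≤
      (u + v) ^ 2 / 4 := by nlinarith [sq_nonneg (ε * (u - v))]
  have hc : 0 ≤ 1 - 4 * ε ^ 2 := by nlinarith
  rw [div_add_div _ _ hA.ne' hB.ne', mul_div_assoc', div_le_div_iff₀ (by positivity) (by positivity)]
  have hk : 0 ≤ (1 - 4 * ε ^ 2) * (u * v) := by positivity
  calc (1 - 4 * ε ^ 2) * (u * v) *
        ((u * (1 / 2 + ε) + v * (1 / 2 - ε)) * (u * (1 / 2 - ε) + v * (1 / 2 + ε)))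
      ≤ (1 - 4 * ε ^ 2) * (u * v) * ((u + v) ^ 2 / 4) := mul_le_mul_of_nonneg_left hAB hk
    _ = _ := by ring

/-- A deterministic strategy cannot have small expected loss under both biases: with prior weights
`u` and `v`, the excess over the optimal rankings is at least `n ε u v / (u + v)`. -/
theorem strategyLoss_lower_bound {ε : ℝ} (hε : 0 ≤ ε) (hε' : ε ≤ 1 / 4)
    (act : List (Fin 2) → Ranking 3) (n : ℕ) (hn : 4 * n * ε ^ 3 + ε ≤ 1) (h : List (Fin 2))
    {u v : ℝ} (hu : 0 < u) (hv : 0 < v) :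
    (u + v) * (n * (7 / 2 - ε)) + n * ε * (u * v / (u + v)) ≤
      u * bitAverage (1 / 2 + ε) n (strategyLoss act h) +
      v * bitAverage (1 / 2 - ε) n (strategyLoss act h) := by
  induction n generalizing h u v with
  | zero => simp [bitAverage, strategyLoss]
  | succ n ih =>
    push_cast at hn
    have hε3 : 0 ≤ ε ^ 3 := by positivity
    specialize ih (by nlinarith)
    set g := u * v / (u + v) with hg
    have hgu : g ≤ u := by rw [hg, div_le_iff₀ (by positivity)]; nlinarith
    have hgv : g ≤ v := by rw [hg, div_le_iff₀ (by positivity)]; nlinarith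
    have hguv : g ≤ (u + v) / 4 := by
      rw [hg, div_le_iff₀ (by positivity)]; nlinarith [sq_nonneg (u - v)]
    have hg0 : 0 ≤ g := by positivity
    have hεu := mul_le_mul_of_nonneg_left hgu hε
    have hεv := mul_le_mul_of_nonneg_left hgv hε
    have hεpu := mul_le_mul_of_nonneg_left hε' hu.le
    have hεpv := mul_le_mul_of_nonneg_left hε' hv.le
    have hεu0 := mul_nonneg hε hu.le
    have hεv0 := mul_nonneg hε hv.le
    simp only [bitAverage, strategyLoss, bitAverage_const_add, sumLoss_bitRelevance_one,
      sumLoss_bitRelevance_zero, topFeedback]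
    have h1 : 0 < 1 / 2 + ε := by linarith
    have h2 : 0 < 1 / 2 - ε := by linarith
    have hsplit := harmonic_split_le hu hv hε hε'
    rw [← hg] at hsplit
    have hnε : 0 ≤ n * ε := by positivity
    have hs := mul_le_mul_of_nonneg_left hsplit hnε
    -- Exploring loses at most `4 n ε³ g` of future potential, plus the `ε g` owed for this round;
    -- the immediate excess, at least `(u + v) / 4`, pays for both.
    have hcost : (4 * n * ε ^ 3 + ε) * g ≤ (u + v) / 4 := by
      have : 4 * n * ε ^ 3 + ε ≤ 1 := by nlinarith
      nlinarith
    push_cast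
    rcases ranking_three_cases (act h) with ⟨ht, hc⟩ | ⟨ht, hc⟩ | ⟨ht, hc⟩
    -- No information: the weights stay, and the order of `1` and `2` is wrong for one bias, costing
    -- `2ε u` or `2ε v`, hence at least `ε g`.
    · have e (x : Fin 2) : bitRelevance x ((act h).symm 0) = 1 := by simp [ht, bitRelevance]
      simp only [e]
      have hi := ih (h ++ [1]) hu hv
      rcases hc with ⟨h0, h1, h2⟩ | ⟨h0, h1, h2⟩ <;> rw [h0, h1, h2] <;> norm_num <;> linarith
    -- The feedback reveals the bit, so the weights are updated by Bayes' rule.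
    · have e (x : Fin 2) : bitRelevance x ((act h).symm 0) = x := by simp [ht, bitRelevance]
      simp only [e]
      have hi := ih (h ++ [1]) (mul_pos hu h1) (mul_pos hv h2)
      have hi' := ih (h ++ [0]) (mul_pos hu h2) (mul_pos hv h1)
      rcases hc with ⟨h0, h1, h2⟩ | ⟨h0, h1, h2⟩ <;> rw [h0, h1, h2] <;> norm_num <;> linarith
    · have e (x : Fin 2) : bitRelevance x ((act h).symm 0) = 1 - x := by simp [ht, bitRelevance]
      simp only [e]
      have hi := ih (h ++ [1 - 1]) (mul_pos hu h1) (mul_pos hv h2)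
      have hi' := ih (h ++ [1 - 0]) (mul_pos hu h2) (mul_pos hv h1)
      rcases hc with ⟨h0, h1, h2⟩ | ⟨h0, h1, h2⟩ <;> rw [h0, h1, h2] <;> norm_num at * <;> linarith

/-! ### From strategies to regret -/

/-- The relevance vectors encoded by a list of bits, continued by the bit `0`. -/
def listRelevance (l : List (Fin 2)) (t : ℕ) : Relevance 3 := bitRelevance (l.getD t 0)

theorem sum_sumLoss_listRelevance (σ : Ranking 3) (l : List (Fin 2)) :
    ∑ t ∈ Finset.range l.length, sumLoss σ (listRelevance l t) =
      (l.map fun x => sumLoss σ (bitRelevance x)).sum := by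
  induction l with
  | nil => simp
  | cons x l ih =>
    rw [List.length_cons, Finset.sum_range_succ', List.map_cons, List.sum_cons, ← ih, add_comm]
    rfl

namespace OnlineAlgorithm

variable {Ω : Type*} [MeasurableSpace Ω]

theorem sum_sumLoss_ranking_eq_strategyLoss (A : OnlineAlgorithm 3 Ω) (r : ℕ → Relevance 3) (ω : Ω)
    (l : List (Fin 2)) (t : ℕ) (hr : ∀ i, r (t + i) = listRelevance l i) :
    ∑ i ∈ Finset.range l.length, sumLoss (A.ranking r ω (t + i)) (r (t + i)) =
      strategyLoss (A.act ω) (A.history r ω t) l := by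
  induction l generalizing t with
  | nil => simp [strategyLoss]
  | cons x l ih =>
    have h0 : r t = bitRelevance x := hr 0
    have hs := ih (t + 1) fun i => by
      rw [add_assoc, add_comm 1 i, hr (i + 1)]
      rfl
    rw [List.length_cons, Finset.sum_range_succ', strategyLoss, add_comm, add_zero]
    congr 1
    · rw [ranking, h0]
    · rw [history, h0] at hs
      rw [← hs]
      exact Finset.sum_congr rfl fun i _ => by rw [add_assoc, add_comm 1 i]

/-- Adding a constant to the loss does not decrease the regret. -/
theorem regret_le_regret_of_eq_add_const (A : OnlineAlgorithm 3 Ω)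
    (loss loss' : Ranking 3 → Relevance 3 → ℝ) (μ : Measure Ω) [IsProbabilityMeasure μ]
    (r : ℕ → Relevance 3) (T : ℕ) (k : ℝ) (hk : ∀ σ t, loss' σ (r t) = loss σ (r t) + k) :
    A.regret loss μ r T ≤ A.regret loss' μ r T := by
  obtain ⟨σ, -, hσ⟩ := Finset.exists_mem_eq_inf' (s := Finset.univ) Finset.univ_nonempty
    (fun σ : Ranking 3 => ∑ t ∈ Finset.range T, loss σ (r t))
  have hle := Finset.inf'_le (fun σ : Ranking 3 => ∑ t ∈ Finset.range T, loss' σ (r t))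
    (Finset.mem_univ σ)
  unfold regret
  rw [hσ]
  simp only [hk, Finset.sum_add_distrib, Finset.sum_const, Finset.card_range] at hle ⊢
  rw [integral_add (A.integrable_loss loss μ r T) (integrable_const _)]
  simp only [integral_const, probReal_univ, one_smul]
  linarith

theorem integrable_strategyLoss (A : OnlineAlgorithm 3 Ω) (μ : Measure Ω) [IsProbabilityMeasure μ]
    (l : List (Fin 2)) : Integrable (fun ω => strategyLoss (A.act ω) [] l) μ := by
  have e (ω : Ω) := A.sum_sumLoss_ranking_eq_strategyLoss (listRelevance l) ω l 0
    fun i => by rw [zero_add]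
  simp only [zero_add, history] at e
  simpa only [e] using A.integrable_loss sumLoss μ (listRelevance l) l.length

theorem sub_le_regret_listRelevance (A : OnlineAlgorithm 3 Ω) (μ : Measure Ω) (l : List (Fin 2))
    (σ : Ranking 3) :
    ∫ ω, strategyLoss (A.act ω) [] l ∂μ + (l.map fun x => -sumLoss σ (bitRelevance x)).sum ≤
      A.regret sumLoss μ (listRelevance l) l.length := by
  have e (ω : Ω) := A.sum_sumLoss_ranking_eq_strategyLoss (listRelevance l) ω l 0
    fun i => by rw [zero_add]
  simp only [zero_add, history] at e
  have hle := Finset.inf'_le (fun σ : Ranking 3 =>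
    ∑ t ∈ Finset.range l.length, sumLoss σ (listRelevance l t)) (Finset.mem_univ σ)
  have hneg : (l.map fun x => -sumLoss σ (bitRelevance x)).sum =
      -(l.map fun x => sumLoss σ (bitRelevance x)).sum := by
    rw [List.sum_neg, List.map_map]
    rfl
  rw [sum_sumLoss_listRelevance] at hle
  unfold regret
  simp only [e]
  linarith

/-- Some relevance vectors force the regret to be at least `T ε / 4`. -/
theorem exists_le_regret (A : OnlineAlgorithm 3 Ω) (μ : Measure Ω) [IsProbabilityMeasure μ] (T : ℕ)
    {ε : ℝ} (hε : 0 ≤ ε) (hε' : ε ≤ 1 / 4) (hT : 4 * T * ε ^ 3 + ε ≤ 1) :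
    ∃ l : List (Fin 2), T * ε / 4 ≤ A.regret sumLoss μ (listRelevance l) T := by
  have hI (p : ℝ) := integrable_bitAverage_and_integral (p := p) T
    (fun ω => strategyLoss (A.act ω) []) (A.integrable_strategyLoss μ)
  have hlow : T * (7 / 2 - ε) + T * ε / 4 ≤
      1 / 2 * bitAverage (1 / 2 + ε) T (fun l => ∫ ω, strategyLoss (A.act ω) [] l ∂μ) +
      1 / 2 * bitAverage (1 / 2 - ε) T (fun l => ∫ ω, strategyLoss (A.act ω) [] l ∂μ) := by
    rw [← (hI _).2, ← (hI _).2, ← integral_const_mul, ← integral_const_mul,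
      ← integral_add ((hI _).1.const_mul _) ((hI _).1.const_mul _)]
    have hc : T * (7 / 2 - ε) + T * ε / 4 = ∫ _ : Ω, (T * (7 / 2 - ε) + T * ε / 4) ∂μ := by simp
    rw [hc]
    refine integral_mono (integrable_const _)
      (((hI _).1.const_mul _).add ((hI _).1.const_mul _)) fun ω => ?_
    have := strategyLoss_lower_bound hε hε' (A.act ω) T hT []
      (show (0 : ℝ) < 1 / 2 by norm_num) (show (0 : ℝ) < 1 / 2 by norm_num)
    norm_num at this ⊢
    linarith
  -- `σ` is the optimal ranking for bias `p`. The regret is bounded below by comparison with this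
  -- fixed `σ`, so the quantity averaged is additive over rounds.
  have main (p : ℝ) (hp : 0 ≤ p) (hp' : p ≤ 1) (σ : Ranking 3)
      (hσ : p * sumLoss σ (bitRelevance 1) + (1 - p) * sumLoss σ (bitRelevance 0) = 7 / 2 - ε)
      (hW : T * (7 / 2 - ε) + T * ε / 4 ≤
        bitAverage p T (fun l => ∫ ω, strategyLoss (A.act ω) [] l ∂μ)) :
      ∃ l : List (Fin 2), T * ε / 4 ≤ A.regret sumLoss μ (listRelevance l) T := by
    obtain ⟨l, rfl, h⟩ := exists_bitAverage_le hp hp' T (fun l =>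
      ∫ ω, strategyLoss (A.act ω) [] l ∂μ + (l.map fun x => -sumLoss σ (bitRelevance x)).sum)
    refine ⟨l, le_trans ?_ (h.trans (A.sub_le_regret_listRelevance μ l σ))⟩
    rw [bitAverage_add, bitAverage_sum_map,
      show p * -sumLoss σ (bitRelevance 1) + (1 - p) * -sumLoss σ (bitRelevance 0) =
        -(7 / 2 - ε) by rw [← hσ]; ring]
    linarith
  rcases le_total (bitAverage (1 / 2 + ε) T (fun l => ∫ ω, strategyLoss (A.act ω) [] l ∂μ))
    (bitAverage (1 / 2 - ε) T (fun l => ∫ ω, strategyLoss (A.act ω) [] l ∂μ)) with h | h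
  · refine main (1 / 2 - ε) (by linarith) (by linarith) (Equiv.swap 1 2) ?_ (by linarith)
    rw [sumLoss_bitRelevance_one, sumLoss_bitRelevance_zero,
      show (Equiv.swap 1 2 : Ranking 3) 0 = 0 by decide,
      show (Equiv.swap 1 2 : Ranking 3) 1 = 2 by decide,
      show (Equiv.swap 1 2 : Ranking 3) 2 = 1 by decide]
    norm_num
    ring
  · refine main (1 / 2 + ε) (by linarith) (by linarith) 1 ?_ (by linarith)
    rw [sumLoss_bitRelevance_one, sumLoss_bitRelevance_zero]
    norm_num
    ring

end OnlineAlgorithm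

theorem mainTheorem2 :
    ∃ c : ℝ, 0 < c ∧
      ∀ (Ω : Type*) [MeasurableSpace Ω] (μ : Measure Ω) [IsProbabilityMeasure μ]
        (A : OnlineAlgorithm 3 Ω) (T : ℕ), 1 ≤ T →
        ∃ r : ℕ → Relevance 3,
          c * (T : ℝ) ^ (2 / 3 : ℝ) ≤ A.regret sumLoss μ r T ∧
          c * (T : ℝ) ^ (2 / 3 : ℝ) ≤ A.regret pairwiseLoss μ r T := by
  refine ⟨1 / 16, by norm_num, fun Ω _ μ _ A T hT => ?_⟩
  have hT1 : (1 : ℝ) ≤ T := by exact_mod_cast hT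
  have hT0 : (0 : ℝ) < T := by linarith
  set d : ℝ := (T : ℝ) ^ (-(1 / 3) : ℝ) with hd
  have hd0 : 0 ≤ d := by positivity
  have hd1 : d ≤ 1 := Real.rpow_le_one_of_one_le_of_nonpos hT1 (by norm_num)
  have hd3 : T * d ^ 3 = 1 := by
    rw [hd, ← Real.rpow_natCast, ← Real.rpow_mul hT0.le]
    norm_num
    rw [Real.rpow_neg_one, mul_inv_cancel₀ hT0.ne']
  have hd2 : (T : ℝ) ^ (2 / 3 : ℝ) = T * d := by
    rw [hd]
    nth_rewrite 2 [← Real.rpow_one (T : ℝ)]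
    rw [← Real.rpow_add hT0]
    norm_num
  -- With `ε = d / 4` the condition reads `1 / 16 + d / 4 ≤ 1`, and `T ε / 4 = T d / 16` gives the
  -- constant.
  obtain ⟨l, hl⟩ := A.exists_le_regret μ T (ε := d / 4) (by positivity) (by linarith)
    (by nlinarith)
  have hl' : 1 / 16 * (T : ℝ) ^ (2 / 3 : ℝ) ≤ A.regret sumLoss μ (listRelevance l) T := by
    rw [hd2]
    linarith
  refine ⟨listRelevance l, hl', hl'.trans ?_⟩
  exact A.regret_le_regret_of_eq_add_const _ _ μ _ T (-3) fun σ t => by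
    rw [listRelevance, pairwiseLoss_bitRelevance, sub_eq_add_neg]
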